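/- Let $M$ be a smooth manifold (without boundary, Hausdorff) of dimension $m$, let $E\to M$ be a smooth real vector bundle of rank $n$, and let $\Gamma(E)$ be the real vector space of smooth sections of $E$. For $u\in C^\infty(M)$ let $\gamma_u\in \mathrm{End}_{\mathbb R}(\Gamma(E))$ be the multiplication $s\mapsto us$. Define $\mathcal P^0(E,M)=\{\gamma_u : u\in C^\infty(M)\}$ and, for $k\ge 0$, $$\mathcal P^{k+1}(E,M)=\{T\in \mathrm{End}_{\mathbb R}(\Gamma(E)) : [T,\gamma_u]=T\gamma_u-\gamma_uT\in\mathcal P^k(E,M)\ \text{ for all } u\in C^\infty(M)\}.$$ Let $k\ge 1$ and $T\in \mathrm{End}_{\mathbb R}(\Gamma(E))$. Then $T\in\mathcal P^k(E,M)$ if and only if the following holds for every domain $U\subset M$ of a smooth chart of $M$ and every smooth vector bundle trivialization of $E$ defined over $U$: there are smooth functions $T_\alpha\in C^\infty(U,gl(n,\mathbb R))$ for the multi-indices $\alpha\in\mathbb N^m$ with $|\alpha|<k$, and smooth scalar functions $u_\beta\in C^\infty(U)$ for $|\beta|=k$, such that for every $s\in\Gamma(E)$, writing sections over $U$ as $\mathbb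 R^n$-valued functions by means of the trivialization and $\partial^\alpha$ for the iterated partial derivatives in the chart, $$(Ts)|_U=\sum_{|\alpha|<k}T_\alpha\,\partial^\alpha (s|_U)+\sum_{|\beta|=k}u_\beta\,\partial^\beta (s|_U).$$ -/

import Mathlib

open Bundle
open scoped Manifold ContDiff

noncomputable section

namespace QuantumPoisson

/-- The partial derivative `∂ᵢ f` of a vector-valued function on `ℝᵐ`. -/
def partialDeriv {m : ℕ} {F : Type*} [NormedAddCommGroup F] [NormedSpace ℝ F]
    (i : Fin m) (f : EuclideanSpace ℝ (Fin m) → F) : EuclideanSpace ℝ (Fin m) → F :=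
  fun y => fderiv ℝ f y (EuclideanSpace.single i (1 : ℝ))

/-- The iterated partial derivative `∂^α f = ∂₀^{α₀} ⋯ ∂_{m-1}^{α_{m-1}} f` for a multi-index `α`. -/
def multiDeriv {m : ℕ} {F : Type*} [NormedAddCommGroup F] [NormedSpace ℝ F]
    (α : Fin m → ℕ) (f : EuclideanSpace ℝ (Fin m) → F) : EuclideanSpace ℝ (Fin m) → F :=
  (List.finRange m).foldr (fun i g => (partialDeriv i)^[α i] g) f

/-- The finite set of multi-indices `α ∈ ℕᵐ` with `|α| = j`. -/
def multiIndices (m j : ℕ) : Finset (Fin m → ℕ) :=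
  Finset.piAntidiag Finset.univ j

section Bundle

variable {m n : ℕ}
  {M : Type*} [TopologicalSpace M] [ChartedSpace (EuclideanSpace ℝ (Fin m)) M]
  {E : M → Type*} [∀ x, AddCommGroup (E x)] [∀ x, Module ℝ (E x)]
  [∀ x, TopologicalSpace (E x)] [TopologicalSpace (TotalSpace (Fin n → ℝ) E)]
  [FiberBundle (Fin n → ℝ) E]

/-- The operator `γ_u : s ↦ u s` of multiplication by a smooth function `u`, as an endomorphism
of the real vector space `Γ(E)` of smooth sections. -/
def mulOp [VectorBundle ℝ (Fin n → ℝ) E] (u : C^∞⟮𝓡 m, M; ℝ⟯) :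
    Module.End ℝ Cₛ^∞⟮𝓡 m; Fin n → ℝ, E⟯ where
  toFun s := ⟨fun x => u x • s x, u.contMDiff.smul_section s.contMDiff⟩
  map_add' s t := by
    ext x
    exact smul_add (u x) (s x) (t x)
  map_smul' c s := by
    ext x
    exact smul_comm (u x) c (s x)

variable (m n M E) in
/-- The filtration `P^k(E, M)`: `P^0` consists of the multiplications `γ_u`, and
`T ∈ P^{k+1}` iff `[T, γ_u] = T γ_u - γ_u T ∈ P^k` for all smooth functions `u` on `M`. -/
def opFiltration [VectorBundle ℝ (Fin n → ℝ) E] :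
    ℕ → Set (Module.End ℝ Cₛ^∞⟮𝓡 m; Fin n → ℝ, E⟯)
  | 0 => Set.range mulOp
  | k + 1 => {T | ∀ u : C^∞⟮𝓡 m, M; ℝ⟯, T * mulOp u - mulOp u * T ∈ opFiltration k}

/-- A smooth vector bundle trivialization: a fibrewise linear local trivialization which is a
smooth diffeomorphism from its source (the restriction of `E` to the base set) onto its target. -/
structure IsSmoothTrivialization (m : ℕ) [ChartedSpace (EuclideanSpace ℝ (Fin m)) M]
    (e : Trivialization (Fin n → ℝ) (TotalSpace.proj : TotalSpace (Fin n → ℝ) E → M)) :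
    Prop where
  linear : ∀ b ∈ e.baseSet, IsLinearMap ℝ fun v : E b => (e ⟨b, v⟩).2
  contMDiffOn : ContMDiffOn ((𝓡 m).prod 𝓘(ℝ, Fin n → ℝ)) ((𝓡 m).prod 𝓘(ℝ, Fin n → ℝ)) ∞
    e e.source
  contMDiffOn_symm : ContMDiffOn ((𝓡 m).prod 𝓘(ℝ, Fin n → ℝ)) ((𝓡 m).prod 𝓘(ℝ, Fin n → ℝ)) ∞
    e.toOpenPartialHomeomorph.symm e.target

/-- The `ℝⁿ`-valued function on `φ(U) ⊆ ℝᵐ` representing a section over `U = φ.source` in the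
chart `φ` and the trivialization `e` (the values outside `φ.target` are irrelevant). -/
def localRep (e : Trivialization (Fin n → ℝ) (TotalSpace.proj : TotalSpace (Fin n → ℝ) E → M))
    (φ : OpenPartialHomeomorph M (EuclideanSpace ℝ (Fin m))) (s : ∀ x, E x) :
    EuclideanSpace ℝ (Fin m) → (Fin n → ℝ) :=
  fun y => (e ⟨φ.symm y, s (φ.symm y)⟩).2

/-- Over `U = φ.source`, in the coordinates `φ` and the trivialization `e`, the operator `T` is
`∑_{|α| < k} T_α ∂^α + ∑_{|β| = k} u_β ∂^β` with smooth `T_α : U → gl(n, ℝ)`, `u_β : U → ℝ`. -/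
def HasLocalForm [VectorBundle ℝ (Fin n → ℝ) E] (k : ℕ)
    (e : Trivialization (Fin n → ℝ) (TotalSpace.proj : TotalSpace (Fin n → ℝ) E → M))
    (φ : OpenPartialHomeomorph M (EuclideanSpace ℝ (Fin m)))
    (T : Module.End ℝ Cₛ^∞⟮𝓡 m; Fin n → ℝ, E⟯) : Prop :=
  ∃ (A : (Fin m → ℕ) → M → Matrix (Fin n) (Fin n) ℝ) (u : (Fin m → ℕ) → M → ℝ),
    (∀ α i j, ContMDiffOn (𝓡 m) 𝓘(ℝ, ℝ) ∞ (fun x => A α x i j) φ.source) ∧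
    (∀ β, ContMDiffOn (𝓡 m) 𝓘(ℝ, ℝ) ∞ (u β) φ.source) ∧
    ∀ (s : Cₛ^∞⟮𝓡 m; Fin n → ℝ, E⟯), ∀ x ∈ φ.source,
      (e ⟨x, T s x⟩).2 =
        (∑ j ∈ Finset.range k, ∑ α ∈ multiIndices m j,
          (A α x).mulVec (multiDeriv α (localRep e φ s) (φ x)))
        + ∑ β ∈ multiIndices m k, u β x • multiDeriv β (localRep e φ s) (φ x)

end Bundle

end QuantumPoisson

end

open MeasureTheory Filter
open scoped Topology Convolution

noncomputable section

namespace QuantumPoisson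

/-! ### Parametric integrals and Hadamard's lemma -/

/-! Evaluated at a point `x`, the commutator `[T, γ_u]` sends `s` to `T((u - u(x)) s)(x)`, because
the constant `u(x)` commutes with the linear map `T`. Iterating (`iterComm_apply`), a `k`-fold
commutator at `x` is `T` applied to `s` times a product of `k` functions vanishing at `x`, and `T`
lies in the `k`-th stage iff all of these commutators are multiplications.

Forward direction: let `I` be the functions vanishing at `x`. One more factor from `I` makes the
value zero, so `T(hs)(x) = 0` for `h ∈ I^(k+1)` (`apply_mulOp_eq_zero`). Hence `T` is local, and by
Taylor expansion modulo `I^(k+1)` (`linearMap_ext_taylor`, based on Hadamard's lemma) `T s (x)` is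
determined by the derivatives of order at most `k`. The coefficient of `∂^α` has `j`-th column
`(1/α!) T((ξ - ξ(x))^α σ_j)(x)`, for coordinates `ξ` and a local frame `σ`. This is a commutator of
`T` applied to `σ_j`, which gives smoothness in `x`; for `|α| = k` that commutator is a
multiplication, so the coefficient is scalar.

Converse: a product `p` of `k` functions vanishing at `x` vanishes there to order `k`. In the local
form of `T(ps)(x)` the terms of order below `k` disappear, and those of order `k` give `∑ u_β ∂^β p
· s(x)`, a scalar multiple of `s(x)`. The scalar is smooth in `x`, as one sees by testing on a frame
section (`mem_range_mulOp`). -/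

theorem contDiff_intervalIntegral_of_contDiff {V : Type*} [NormedAddCommGroup V] [NormedSpace ℝ V]
    {g : V × ℝ → ℝ} (hg : ContDiff ℝ ∞ g) :
    ContDiff ℝ ∞ fun y => ∫ t in (0 : ℝ)..1, g (y, t) := by
  -- The integral is a convolution, evaluated at `0`, of the indicator of `(0, 1]` with the
  -- reflected integrand. The cutoff `ψ` is 1 on `[-1, 1]` and makes the kernel compactly supported.
  let ψ : ContDiffBump (0 : ℝ) := ⟨1, 2, by norm_num, by norm_num⟩
  have h := contDiffOn_convolution_right_with_param_comp (𝕜 := ℝ) (μ := volume) (n := ⊤)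
    (ContinuousLinearMap.mul ℝ ℝ) (s := (Set.univ : Set V)) (v := fun _ => (0 : ℝ))
    (contDiffOn_const) (f := Set.indicator (Set.Ioc (0 : ℝ) 1) 1)
    (g := fun y s => ψ (-s) * g (y, -s)) (k := Metric.closedBall 0 2) isOpen_univ
    (isCompact_closedBall _ _) (by
      intro p x _ hx
      have : ψ (-x) = 0 := by
        apply ψ.zero_of_le_dist
        have : 2 < |x| := by simpa using hx
        simpa [ψ] using this.le
      simp [this])
    (((integrable_indicator_iff measurableSet_Ioc).2
      (integrableOn_const (C := (1 : ℝ)) (by simp))).locallyIntegrable)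
    (by
      apply ContDiff.contDiffOn
      exact (ψ.contDiff.comp contDiff_snd.neg).mul
        (hg.comp (contDiff_fst.prodMk contDiff_snd.neg)))
  rw [contDiffOn_univ] at h
  convert h using 1
  ext y
  rw [intervalIntegral.integral_of_le zero_le_one, convolution_def,
    ← integral_indicator measurableSet_Ioc]
  congr 1
  ext t
  by_cases ht : t ∈ Set.Ioc (0 : ℝ) 1
  · have : ψ t = 1 := ψ.one_of_mem_closedBall (by
      simpa [abs_le] using ⟨by linarith [ht.1], ht.2⟩)
    simp [ht, this]
  · simp [ht]

theorem exists_hadamard_factors {m : ℕ} {F : EuclideanSpace ℝ (Fin m) → ℝ} (hF : ContDiff ℝ ∞ F)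
    (y₀ : EuclideanSpace ℝ (Fin m)) :
    ∃ G : Fin m → EuclideanSpace ℝ (Fin m) → ℝ, (∀ i, ContDiff ℝ ∞ (G i)) ∧
      ∀ y, F y = F y₀ + ∑ i, (y i - y₀ i) * G i y := by
  have hF' : ContDiff ℝ ∞ (fderiv ℝ F) := hF.fderiv_right (by simp)
  have hline : ContDiff ℝ ∞ fun p : EuclideanSpace ℝ (Fin m) × ℝ => y₀ + p.2 • (p.1 - y₀) :=
    contDiff_const.add (contDiff_snd.smul (contDiff_fst.sub contDiff_const))
  have hd (i : Fin m) : ContDiff ℝ ∞ fun p : EuclideanSpace ℝ (Fin m) × ℝ =>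
      fderiv ℝ F (y₀ + p.2 • (p.1 - y₀)) (EuclideanSpace.single i 1) :=
    (hF'.comp hline).clm_apply contDiff_const
  -- The factors come from the fundamental theorem of calculus along the segment from `y₀` to `y`.
  refine ⟨fun i y => ∫ t in (0 : ℝ)..1, fderiv ℝ F (y₀ + t • (y - y₀))
    (EuclideanSpace.single i 1), fun i => contDiff_intervalIntegral_of_contDiff (hd i),
    fun y => ?_⟩
  have hint (i : Fin m) : Continuous fun t : ℝ => fderiv ℝ F (y₀ + t • (y - y₀))
      (EuclideanSpace.single i 1) :=
    (hd i).continuous.comp (by fun_prop : Continuous fun t : ℝ => (y, t))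
  have hderiv (t : ℝ) : HasDerivAt (fun t : ℝ => F (y₀ + t • (y - y₀)))
      (∑ i, (y i - y₀ i) * fderiv ℝ F (y₀ + t • (y - y₀)) (EuclideanSpace.single i 1)) t := by
    have h1 : HasDerivAt (fun t : ℝ => y₀ + t • (y - y₀)) (y - y₀) t := by
      simpa using ((hasDerivAt_id t).smul_const (y - y₀)).const_add y₀
    have h2 := ((hF.differentiable (by simp)) (y₀ + t • (y - y₀))).hasFDerivAt.comp_hasDerivAt t h1
    have h3 : y - y₀ = ∑ i, (y i - y₀ i) • EuclideanSpace.single i (1 : ℝ) := by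
      ext j
      simp [Finset.sum_apply, Pi.single_apply]
    have h4 := congrArg (fderiv ℝ F (y₀ + t • (y - y₀))) h3
    simp only [map_sum, map_smul, smul_eq_mul] at h4
    rw [← h4]
    exact h2
  have h := intervalIntegral.integral_eq_sub_of_hasDerivAt (a := 0) (b := 1)
    (fun t _ => hderiv t)
    ((continuous_finsetSum _ fun i _ => continuous_const.mul (hint i)).intervalIntegrable _ _)
  rw [intervalIntegral.integral_finsetSum
    (fun i _ => ((hint i).const_mul (y i - y₀ i)).intervalIntegrable _ _)] at h
  simp only [intervalIntegral.integral_const_mul, one_smul, zero_smul, add_zero,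
    add_sub_cancel] at h
  linarith

/-! ### Iterated partial derivatives -/

section MultiDeriv

variable {m : ℕ} {F G : Type*} [NormedAddCommGroup F] [NormedSpace ℝ F]
  [NormedAddCommGroup G] [NormedSpace ℝ G] {y : EuclideanSpace ℝ (Fin m)}
  {f g : EuclideanSpace ℝ (Fin m) → F}

theorem multiDeriv_induction {P : (EuclideanSpace ℝ (Fin m) → F) →
      (EuclideanSpace ℝ (Fin m) → G) → Prop} {f : EuclideanSpace ℝ (Fin m) → F}
    {g : EuclideanSpace ℝ (Fin m) → G} (h : P f g)
    (hP : ∀ i f g, P f g → P (partialDeriv i f) (partialDeriv i g)) (α : Fin m → ℕ) :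
    P (multiDeriv α f) (multiDeriv α g) := by
  unfold multiDeriv
  induction List.finRange m with
  | nil => exact h
  | cons i l ih =>
    simp only [List.foldr_cons]
    induction α i with
    | zero => exact ih
    | succ a iha =>
      rw [Function.iterate_succ_apply', Function.iterate_succ_apply']
      exact hP _ _ _ iha

theorem contDiffAt_partialDeriv (i : Fin m) (hf : ContDiffAt ℝ ∞ f y) :
    ContDiffAt ℝ ∞ (partialDeriv i f) y :=
  (hf.fderiv_right (by simp)).clm_apply contDiffAt_const

theorem eventuallyEq_partialDeriv (i : Fin m) (h : f =ᶠ[𝓝 y] g) :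
    partialDeriv i f =ᶠ[𝓝 y] partialDeriv i g := by
  filter_upwards [h.fderiv (𝕜 := ℝ)] with z hz
  simp [partialDeriv, hz]

theorem eventuallyEq_multiDeriv (α : Fin m → ℕ) (h : f =ᶠ[𝓝 y] g) :
    multiDeriv α f =ᶠ[𝓝 y] multiDeriv α g :=
  multiDeriv_induction h (fun i _ _ => eventuallyEq_partialDeriv i) α

theorem eventually_differentiableAt (hf : ContDiffAt ℝ ∞ f y) :
    ∀ᶠ z in 𝓝 y, DifferentiableAt ℝ f z := by
  filter_upwards [(hf.of_le (m := 1) (by simp)).eventually (by simp)] with z hz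
  exact hz.differentiableAt (by simp)

theorem multiDeriv_clm_comp (α : Fin m → ℕ) (L : F →L[ℝ] G) (hf : ContDiffAt ℝ ∞ f y) :
    multiDeriv α (fun z => L (f z)) y = L (multiDeriv α f y) := by
  have := (multiDeriv_induction (P := fun f g => ContDiffAt ℝ ∞ f y ∧ g =ᶠ[𝓝 y] fun z => L (f z))
    ⟨hf, EventuallyEq.rfl⟩ (fun i f g h => ⟨contDiffAt_partialDeriv i h.1, by
      refine (eventuallyEq_partialDeriv i h.2).trans ?_
      filter_upwards [eventually_differentiableAt h.1] with z hz
      simp only [partialDeriv]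
      rw [show (fun z => L (f z)) = L ∘ f from rfl,
        fderiv_comp z L.differentiableAt hz]
      simp⟩) α).2
  exact this.self_of_nhds

/-- Compatibility with continuous linear maps suffices: apply it to the pair `(f, g)` with the two
projections and with their sum. -/
theorem multiDeriv_add (α : Fin m → ℕ) (hf : ContDiffAt ℝ ∞ f y) (hg : ContDiffAt ℝ ∞ g y) :
    multiDeriv α (fun z => f z + g z) y = multiDeriv α f y + multiDeriv α g y := by
  have h1 := multiDeriv_clm_comp α (ContinuousLinearMap.fst ℝ F F) (hf.prodMk hg)
  have h2 := multiDeriv_clm_comp α (ContinuousLinearMap.snd ℝ F F) (hf.prodMk hg)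
  have h3 := multiDeriv_clm_comp α
    (ContinuousLinearMap.fst ℝ F F + ContinuousLinearMap.snd ℝ F F) (hf.prodMk hg)
  simpa [← h1, ← h2] using h3

/-- `f` is smooth at `y` and vanishes there to order `r`. -/
def VanishesAt (y : EuclideanSpace ℝ (Fin m)) : ℕ → (EuclideanSpace ℝ (Fin m) → F) → Prop
  | 0, f => ContDiffAt ℝ ∞ f y
  | r + 1, f => ContDiffAt ℝ ∞ f y ∧ f y = 0 ∧ ∀ i, VanishesAt y r (partialDeriv i f)

namespace VanishesAt

theorem contDiffAt {r : ℕ} (h : VanishesAt y r f) : ContDiffAt ℝ ∞ f y := by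
  cases r with
  | zero => exact h
  | succ r => exact h.1

theorem congr {r : ℕ} (h : VanishesAt y r f) (hfg : f =ᶠ[𝓝 y] g) : VanishesAt y r g := by
  induction r generalizing f g with
  | zero => exact ContDiffAt.congr_of_eventuallyEq h hfg.symm
  | succ r ih =>
    exact ⟨h.1.congr_of_eventuallyEq hfg.symm, hfg.self_of_nhds.symm.trans h.2.1,
      fun i => ih (h.2.2 i) (eventuallyEq_partialDeriv i hfg)⟩

theorem of_succ {r : ℕ} (h : VanishesAt y (r + 1) f) : VanishesAt y r f := by
  induction r generalizing f with
  | zero => exact h.1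
  | succ r ih => exact ⟨h.1, h.2.1, fun i => ih (h.2.2 i)⟩

theorem partialDeriv {r : ℕ} (h : VanishesAt y r f) (i : Fin m) :
    VanishesAt y (r - 1) (partialDeriv i f) := by
  cases r with
  | zero => exact contDiffAt_partialDeriv i h
  | succ r => exact h.2.2 i

theorem multiDeriv {r : ℕ} (h : VanishesAt y r f) (α : Fin m → ℕ) :
    VanishesAt y (r - ∑ i, α i) (multiDeriv α f) := by
  rw [← List.sum_ofFn, List.ofFn_eq_map]
  unfold QuantumPoisson.multiDeriv
  induction List.finRange m with
  | nil => simpa using h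
  | cons i l ih =>
    simp only [List.foldr_cons, List.map_cons, List.sum_cons]
    induction α i with
    | zero => simpa using ih
    | succ a iha =>
      rw [Function.iterate_succ_apply']
      have := iha.partialDeriv i
      rwa [show r - (a + 1 + (l.map α).sum) = r - (a + (l.map α).sum) - 1 by omega]

theorem multiDeriv_eq_zero {r : ℕ} (h : VanishesAt y r f) {α : Fin m → ℕ} (hα : ∑ i, α i < r) :
    QuantumPoisson.multiDeriv α f y = 0 := by
  have := h.multiDeriv α
  obtain ⟨d, hd⟩ : ∃ d, r - ∑ i, α i = d + 1 := ⟨r - ∑ i, α i - 1, by omega⟩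
  rw [hd] at this
  exact this.2.1

theorem add {r : ℕ} (hf : VanishesAt y r f) (hg : VanishesAt y r g) :
    VanishesAt y r (fun z => f z + g z) := by
  induction r generalizing f g with
  | zero => exact ContDiffAt.add hf hg
  | succ r ih =>
    refine ⟨hf.1.add hg.1, by simp [hf.2.1, hg.2.1], fun i => (ih (hf.2.2 i) (hg.2.2 i)).congr ?_⟩
    filter_upwards [eventually_differentiableAt hf.1, eventually_differentiableAt hg.1] with z h1 h2
    simp [QuantumPoisson.partialDeriv, fderiv_fun_add h1 h2]

theorem of_le {r r' : ℕ} (h : VanishesAt y r f) (hr : r' ≤ r) : VanishesAt y r' f := by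
  induction hr with
  | refl => exact h
  | step _ ih => exact ih h.of_succ

/-- Induction on the total order via the Leibniz rule: each term differentiates one factor and loses
at most one order. -/
theorem smul {a b : ℕ} {c : EuclideanSpace ℝ (Fin m) → ℝ} (hc : VanishesAt y a c)
    (hf : VanishesAt y b f) : VanishesAt y (a + b) (fun z => c z • f z) := by
  induction h : a + b generalizing a b c f with
  | zero => exact hc.contDiffAt.smul hf.contDiffAt
  | succ r ih =>
    refine ⟨hc.contDiffAt.smul hf.contDiffAt, ?_, fun i => ?_⟩
    · cases a with
      | succ a => simp [hc.2.1]
      | zero =>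
        obtain rfl : b = r + 1 := by omega
        simp [hf.2.1]
    · have h1 : VanishesAt y r fun z => c z • QuantumPoisson.partialDeriv i f z := by
        -- If `b = 0`, differentiating `f` loses no order, so one order of `c` is discarded to bring
        -- the total down to `r`.
        rcases Nat.eq_zero_or_pos b with hb | hb
        · obtain rfl : b = 0 := hb
          obtain rfl : a = r + 1 := by omega
          exact ih hc.of_succ (hf.partialDeriv i) (by omega)
        · exact ih hc (hf.partialDeriv i) (by omega)
      have h2 : VanishesAt y r fun z => QuantumPoisson.partialDeriv i c z • f z := by
        rcases Nat.eq_zero_or_pos a with ha | ha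
        · obtain rfl : a = 0 := ha
          obtain rfl : b = r + 1 := by omega
          exact ih (hc.partialDeriv i) hf.of_succ (by omega)
        · exact ih (hc.partialDeriv i) hf (by omega)
      refine (h1.add h2).congr ?_
      filter_upwards [eventually_differentiableAt hc.contDiffAt,
        eventually_differentiableAt hf.contDiffAt] with z h1 h2
      simp [QuantumPoisson.partialDeriv, fderiv_fun_smul h1 h2]

end VanishesAt

/-- At the lowest order, a derivative of a product only sees the vanishing factor. -/
theorem multiDeriv_smul_of_vanishesAt {c : EuclideanSpace ℝ (Fin m) → ℝ} {α : Fin m → ℕ}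
    (hc : VanishesAt y (∑ i, α i) c) (hf : ContDiffAt ℝ ∞ f y) :
    multiDeriv α (fun z => c z • f z) y = multiDeriv α c y • f y := by
  -- Replacing `f` by its value at `y` changes the product by a function vanishing to order `|α| +
  -- 1`, which `∂^α` does not see.
  have hf' : VanishesAt y 1 (fun z => f z - f y) :=
    ⟨hf.sub contDiffAt_const, by simp, fun i => contDiffAt_partialDeriv i (hf.sub contDiffAt_const)⟩
  have h1 := (hc.smul hf').multiDeriv_eq_zero (α := α) (by omega)
  have h2 := multiDeriv_clm_comp α (ContinuousLinearMap.toSpanSingleton ℝ (f y)) hc.contDiffAt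
  have h3 := multiDeriv_add α (f := fun z => c z • (f z - f y)) (g := fun z => c z • f y)
    (hc.contDiffAt.smul (hf.sub contDiffAt_const)) (hc.contDiffAt.smul contDiffAt_const)
  simp only [ContinuousLinearMap.toSpanSingleton_apply] at h2
  rw [h1, h2, zero_add] at h3
  rw [← h3]
  congr 1
  ext z
  simp [smul_sub]

end MultiDeriv

/-! ### Derivatives of monomials -/

section Monomial

variable {m : ℕ}

/-- The monomial `(z - y)^γ`. -/
def monomialAt (y : EuclideanSpace ℝ (Fin m)) (γ : Fin m → ℕ) (z : EuclideanSpace ℝ (Fin m)) : ℝ :=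
  ∏ i, (z i - y i) ^ γ i

theorem partialDeriv_const_mul_monomialAt (y : EuclideanSpace ℝ (Fin m)) (γ : Fin m → ℕ) (c : ℝ)
    (i : Fin m) : partialDeriv i (fun z => c * monomialAt y γ z) =
      fun z => c * γ i * monomialAt y (Function.update γ i (γ i - 1)) z := by
  ext z
  have h (j : Fin m) : HasFDerivAt (fun z : EuclideanSpace ℝ (Fin m) => (z j - y j) ^ γ j)
      ((γ j * (z j - y j) ^ (γ j - 1)) • (EuclideanSpace.proj j :
        EuclideanSpace ℝ (Fin m) →L[ℝ] ℝ)) z := by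
    have := (((EuclideanSpace.proj j : EuclideanSpace ℝ (Fin m) →L[ℝ] ℝ).hasFDerivAt
      (x := z)).sub_const (y j)).pow (γ j)
    simpa using this
  have h' := (HasFDerivAt.finsetProd (u := Finset.univ) fun j _ => h j).const_mul c
  simp only [partialDeriv, monomialAt]
  rw [h'.fderiv]
  rw [smul_apply, sum_apply, Finset.sum_eq_single i (by intro b _ hb; simp [hb]) (by simp)]
  rw [← Finset.mul_prod_erase Finset.univ (fun j => (z j - y j) ^
    (Function.update γ i (γ i - 1) j)) (Finset.mem_univ i)]
  have hprod : ∏ j ∈ Finset.univ.erase i, (z j - y j) ^ (Function.update γ i (γ i - 1) j) =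
      ∏ j ∈ Finset.univ.erase i, (z j - y j) ^ γ j :=
    Finset.prod_congr rfl fun j hj => by rw [Function.update_of_ne (Finset.ne_of_mem_erase hj)]
  rw [hprod]
  simp
  ring

theorem iterate_partialDeriv_const_mul_monomialAt (y : EuclideanSpace ℝ (Fin m)) (γ : Fin m → ℕ)
    (c : ℝ) (i : Fin m) (a : ℕ) : (partialDeriv i)^[a] (fun z => c * monomialAt y γ z) =
      fun z => c * (γ i).descFactorial a * monomialAt y (Function.update γ i (γ i - a)) z := by
  induction a with
  | zero => simp
  | succ a ih =>
    rw [Function.iterate_succ_apply', ih, partialDeriv_const_mul_monomialAt]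
    ext z
    simp only [Function.update_self, Function.update_idem, Nat.descFactorial_succ, Nat.cast_mul,
      Nat.sub_sub]
    ring

theorem multiDeriv_monomialAt (y : EuclideanSpace ℝ (Fin m)) (α γ : Fin m → ℕ) :
    multiDeriv α (monomialAt y γ) =
      fun z => (∏ i, ((γ i).descFactorial (α i) : ℝ)) * monomialAt y (fun i => γ i - α i) z := by
  -- Since `l` has no repetitions, each exponent is still untouched when its variable is
  -- differentiated.
  have key (l : List (Fin m)) (hl : l.Nodup) :
      l.foldr (fun i g => (partialDeriv i)^[α i] g) (monomialAt y γ) =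
        fun z => (l.map fun i => ((γ i).descFactorial (α i) : ℝ)).prod *
          monomialAt y (fun i => if i ∈ l then γ i - α i else γ i) z := by
    induction l with
    | nil => simp
    | cons i l ih =>
      rw [List.nodup_cons] at hl
      rw [List.foldr_cons, ih hl.2, iterate_partialDeriv_const_mul_monomialAt]
      ext z
      rw [List.map_cons, List.prod_cons, if_neg hl.1]
      have : Function.update (fun j => if j ∈ l then γ j - α j else γ j) i (γ i - α i) =
          fun j => if j ∈ i :: l then γ j - α j else γ j := by
        ext j
        by_cases hj : j = i
        · subst hj; simp
        · simp [hj]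
      rw [this]
      ring
  have := key _ (List.nodup_finRange m)
  simp only [List.mem_finRange, if_true] at this
  rw [multiDeriv, this, ← List.ofFn_eq_map, List.prod_ofFn]

theorem multiDeriv_monomialAt_self (y : EuclideanSpace ℝ (Fin m)) (α : Fin m → ℕ) :
    multiDeriv α (monomialAt y α) y = ∏ i, ((α i).factorial : ℝ) := by
  simp [multiDeriv_monomialAt, monomialAt, Nat.descFactorial_self]

theorem multiDeriv_monomialAt_of_ne (y : EuclideanSpace ℝ (Fin m)) {α γ : Fin m → ℕ} (h : α ≠ γ) :
    multiDeriv α (monomialAt y γ) y = 0 := by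
  obtain ⟨i, hi⟩ := Function.ne_iff.1 h
  simp only [multiDeriv_monomialAt, monomialAt]
  rcases hi.lt_or_gt with hi | hi
  · rw [mul_eq_zero, Finset.prod_eq_zero_iff (s := Finset.univ) (f := fun i => (y i - y i) ^ _)]
    refine Or.inr ⟨i, Finset.mem_univ i, ?_⟩
    simp only [sub_self]
    exact zero_pow (by omega)
  · rw [mul_eq_zero, Finset.prod_eq_zero_iff]
    refine Or.inl ⟨i, Finset.mem_univ i, ?_⟩
    simp [Nat.descFactorial_eq_zero_iff_lt.2 hi]

end Monomial

/-! ### Smooth functions vanishing at a point -/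

section Functions

variable {m : ℕ} {M : Type*} [TopologicalSpace M] [ChartedSpace (EuclideanSpace ℝ (Fin m)) M]

/-- The space of smooth functions vanishing at `x`. -/
def vanishingAt (x : M) : Submodule ℝ C^∞⟮𝓡 m, M; ℝ⟯ where
  carrier := {h | h x = 0}
  add_mem' {a b} ha hb := by
    simp only [Set.mem_ofPred_eq] at ha hb ⊢
    simp [ha, hb]
  zero_mem' := rfl
  smul_mem' c a ha := by
    simp only [Set.mem_ofPred_eq] at ha ⊢
    simp [ha]

theorem mem_vanishingAt {x : M} {h : C^∞⟮𝓡 m, M; ℝ⟯} : h ∈ vanishingAt x ↔ h x = 0 := Iff.rfl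

/-- The function `u - u(x)`. -/
def centered (x : M) (u : C^∞⟮𝓡 m, M; ℝ⟯) : C^∞⟮𝓡 m, M; ℝ⟯ :=
  u - algebraMap ℝ _ (u x)

@[simp]
theorem centered_apply (x : M) (u : C^∞⟮𝓡 m, M; ℝ⟯) (z : M) : centered x u z = u z - u x := rfl

theorem centered_mem (x : M) (u : C^∞⟮𝓡 m, M; ℝ⟯) : centered x u ∈ vanishingAt x := by
  simp [mem_vanishingAt]

theorem prod_map_centered_mem (x : M) (l : List C^∞⟮𝓡 m, M; ℝ⟯) :
    (l.map (centered x)).prod ∈ vanishingAt x ^ l.length := by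
  induction l with
  | nil => simpa using ⟨1, map_one _⟩
  | cons a l ih =>
    rw [List.map_cons, List.prod_cons, List.length_cons, pow_succ']
    exact Submodule.mul_mem_mul (centered_mem x a) ih

theorem centered_of_mem {x : M} {u : C^∞⟮𝓡 m, M; ℝ⟯} (hu : u ∈ vanishingAt x) :
    centered x u = u := by
  ext z
  simp [mem_vanishingAt.1 hu]

@[simp]
theorem coe_list_prod (l : List C^∞⟮𝓡 m, M; ℝ⟯) (z : M) :
    l.prod z = (l.map fun u => u z).prod := by
  induction l with
  | nil => rfl
  | cons a l ih =>
    rw [List.prod_cons, List.map_cons, List.prod_cons, ← ih]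
    rfl

@[simp]
theorem coe_pow_apply (u : C^∞⟮𝓡 m, M; ℝ⟯) (k : ℕ) (z : M) : (u ^ k) z = u z ^ k := by
  induction k with
  | zero => simp
  | succ k ih => rw [pow_succ, pow_succ, ← ih]; rfl

variable [T2Space M] [IsManifold (𝓡 m) ∞ M]

theorem exists_bump {x : M} {U : Set M} (hU : U ∈ 𝓝 x) :
    ∃ χ : C^∞⟮𝓡 m, M; ℝ⟯, tsupport χ ⊆ U ∧ ∀ᶠ z in 𝓝 x, χ z = 1 := by
  obtain ⟨f, -, hf⟩ := (SmoothBumpFunction.nhds_basis_tsupport (I := 𝓡 m) x).mem_iff.1 hU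
  exact ⟨⟨f, f.contMDiff⟩, hf, f.eventuallyEq_one⟩

/-- A function or section that is zero wherever `P` holds is unchanged by multiplication by any
power of this `χ`; this is how germs vanishing at `x` are placed in high powers of the ideal. -/
theorem exists_bump_vanishing {x : M} {P : M → Prop} (hP : ∀ᶠ z in 𝓝 x, P z) :
    ∃ χ ∈ vanishingAt (m := m) x, ∀ z, χ z = 1 ∨ P z := by
  obtain ⟨χ, h1, h2⟩ := exists_bump (m := m) hP
  refine ⟨1 - χ, by simp [mem_vanishingAt, h2.self_of_nhds], fun z => ?_⟩
  by_cases hz : z ∈ tsupport χ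
  · exact Or.inr (h1 hz)
  · left
    simp [image_eq_zero_of_notMem_tsupport hz]

theorem mem_vanishingAt_pow_of_eventually_eq_zero {x : M} {h : C^∞⟮𝓡 m, M; ℝ⟯}
    (hh : ∀ᶠ z in 𝓝 x, h z = 0) (r : ℕ) : h ∈ vanishingAt x ^ (r + 1) := by
  obtain ⟨χ, hχ, h2⟩ := exists_bump_vanishing (m := m) hh
  have : h = χ ^ r * h := by
    ext z
    rcases h2 z with hz | hz <;> simp [hz]
  rw [this, pow_succ]
  exact Submodule.mul_mem_mul (Submodule.pow_mem_pow _ hχ r) hh.self_of_nhds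

theorem exists_global_function {U : Set M} (hU : IsOpen U) {x : M} (hx : x ∈ U) {g : M → ℝ}
    (hg : ContMDiffOn (𝓡 m) 𝓘(ℝ, ℝ) ∞ g U) :
    ∃ h : C^∞⟮𝓡 m, M; ℝ⟯, ∀ᶠ z in 𝓝 x, h z = g z := by
  obtain ⟨χ, h1, h2⟩ := exists_bump (m := m) (hU.mem_nhds hx)
  refine ⟨⟨fun z => χ z * g z, contMDiff_of_tsupport fun z hz => ?_⟩, ?_⟩
  · have hzU : z ∈ U := h1 (closure_mono (Function.support_mul_subset_left _ _) hz)
    exact (χ.contMDiff.contMDiffAt).mul (hg.contMDiffAt (hU.mem_nhds hzU))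
  · filter_upwards [h2] with z hz
    change χ z * g z = g z
    rw [hz, one_mul]

end Functions

/-! ### Iterated commutators -/

section Operators

variable {m n : ℕ}
  {M : Type*} [TopologicalSpace M] [ChartedSpace (EuclideanSpace ℝ (Fin m)) M]
  {E : M → Type*} [∀ x, AddCommGroup (E x)] [∀ x, Module ℝ (E x)]
  [∀ x, TopologicalSpace (E x)] [TopologicalSpace (TotalSpace (Fin n → ℝ) E)]
  [FiberBundle (Fin n → ℝ) E] [VectorBundle ℝ (Fin n → ℝ) E]

@[simp]
theorem mulOp_apply (u : C^∞⟮𝓡 m, M; ℝ⟯) (s : Cₛ^∞⟮𝓡 m; Fin n → ℝ, E⟯) (x : M) :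
    mulOp u s x = u x • s x := rfl

theorem mulOp_mul (u v : C^∞⟮𝓡 m, M; ℝ⟯) (s : Cₛ^∞⟮𝓡 m; Fin n → ℝ, E⟯) :
    mulOp (u * v) s = mulOp u (mulOp v s) := by
  ext x
  exact mul_smul (u x) (v x) (s x)

theorem mulOp_one (s : Cₛ^∞⟮𝓡 m; Fin n → ℝ, E⟯) :
    mulOp (1 : C^∞⟮𝓡 m, M; ℝ⟯) s = s := by
  ext x
  exact one_smul ℝ (s x)

theorem mulOp_add (u v : C^∞⟮𝓡 m, M; ℝ⟯) (s : Cₛ^∞⟮𝓡 m; Fin n → ℝ, E⟯) :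
    mulOp (u + v) s = mulOp u s + mulOp v s := by
  ext x
  exact add_smul (u x) (v x) (s x)

theorem mulOp_smul (c : ℝ) (v : C^∞⟮𝓡 m, M; ℝ⟯) (s : Cₛ^∞⟮𝓡 m; Fin n → ℝ, E⟯) :
    mulOp (c • v) s = c • mulOp v s := by
  ext x
  exact mul_smul c (v x) (s x)

theorem mulOp_zero (s : Cₛ^∞⟮𝓡 m; Fin n → ℝ, E⟯) :
    mulOp (0 : C^∞⟮𝓡 m, M; ℝ⟯) s = 0 := by
  ext x
  exact zero_smul ℝ (s x)

theorem mulOp_centered (x : M) (u : C^∞⟮𝓡 m, M; ℝ⟯) (s : Cₛ^∞⟮𝓡 m; Fin n → ℝ, E⟯) :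
    mulOp (centered x u) s = mulOp u s - u x • s := by
  ext z
  exact sub_smul (u z) (u x) (s z)

/-- The iterated commutator of `T` with the multiplications by the members of a list. -/
def iterComm : List C^∞⟮𝓡 m, M; ℝ⟯ → Module.End ℝ Cₛ^∞⟮𝓡 m; Fin n → ℝ, E⟯ →
    Module.End ℝ Cₛ^∞⟮𝓡 m; Fin n → ℝ, E⟯
  | [], T => T
  | u :: l, T => iterComm l (T * mulOp u - mulOp u * T)

theorem iterComm_apply (l : List C^∞⟮𝓡 m, M; ℝ⟯) (T : Module.End ℝ Cₛ^∞⟮𝓡 m; Fin n → ℝ, E⟯)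
    (s : Cₛ^∞⟮𝓡 m; Fin n → ℝ, E⟯) (x : M) :
    iterComm l T s x = T (mulOp (l.map (centered x)).prod s) x := by
  induction l generalizing T with
  | nil => simp [iterComm, mulOp_one]
  | cons u l ih =>
    rw [iterComm, ih, List.map_cons, List.prod_cons, mulOp_mul, mulOp_centered, map_sub, map_smul]
    rfl

theorem mem_opFiltration_iff {k : ℕ} {T : Module.End ℝ Cₛ^∞⟮𝓡 m; Fin n → ℝ, E⟯} :
    T ∈ opFiltration m n M E k ↔
      ∀ l : List C^∞⟮𝓡 m, M; ℝ⟯, l.length = k → iterComm l T ∈ Set.range mulOp := by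
  induction k generalizing T with
  | zero => simp [opFiltration, iterComm]
  | succ k ih =>
    constructor
    · rintro hT (_ | ⟨u, l⟩) hl
      · simp at hl
      · exact ih.1 (hT u) l (by simpa using hl)
    · exact fun h u => ih.2 fun l hl => h (u :: l) (by simp [hl])

variable {k : ℕ} {T : Module.End ℝ Cₛ^∞⟮𝓡 m; Fin n → ℝ, E⟯}

/-- For a product of `k + 1` factors, `k` of them form a commutator, which is a multiplication; it
acts on a section that the remaining factor makes zero at `x`. -/
theorem apply_mulOp_eq_zero (hT : T ∈ opFiltration m n M E k) {x : M} {h : C^∞⟮𝓡 m, M; ℝ⟯}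
    (hh : h ∈ vanishingAt x ^ (k + 1)) (s : Cₛ^∞⟮𝓡 m; Fin n → ℝ, E⟯) : T (mulOp h s) x = 0 := by
  rw [Submodule.pow_eq_span_pow_set] at hh
  induction hh using Submodule.span_induction with
  | zero => rw [mulOp_zero, map_zero]; rfl
  | add a b _ _ ha hb =>
    rw [mulOp_add, map_add, ContMDiffSection.coe_add, Pi.add_apply, ha, hb, add_zero]
  | smul c a _ ha =>
    rw [mulOp_smul, map_smul, ContMDiffSection.coe_smul, Pi.smul_apply, ha, smul_zero]
  | mem a ha =>
    obtain ⟨f, rfl⟩ := Set.mem_pow.1 ha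
    rw [List.ofFn_succ, List.prod_cons, mul_comm, mulOp_mul]
    obtain ⟨v, hv⟩ := mem_opFiltration_iff.1 hT (List.ofFn fun i : Fin k => ↑(f i.succ)) (by simp)
    have h1 := iterComm_apply (List.ofFn fun i : Fin k => ↑(f i.succ)) T (mulOp (f 0) s) x
    have h2 : (List.ofFn fun i : Fin k => (↑(f i.succ) : C^∞⟮𝓡 m, M; ℝ⟯)).map (centered x) =
        List.ofFn fun i : Fin k => ↑(f i.succ) := by
      rw [List.map_ofFn]
      congr 1
      ext1 i
      exact centered_of_mem (f i.succ).2
    rw [h2, ← hv] at h1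
    rw [← h1, mulOp_apply, mulOp_apply, mem_vanishingAt.1 (f 0).2, zero_smul, smul_zero]

variable [T2Space M] [IsManifold (𝓡 m) ∞ M]

/-- Locality: `s - t` equals `χ^(k+1) (s - t)` for some `χ` vanishing at `x`. -/
theorem apply_congr_of_eventuallyEq (hT : T ∈ opFiltration m n M E k) {x : M}
    {s t : Cₛ^∞⟮𝓡 m; Fin n → ℝ, E⟯} (h : ∀ᶠ z in 𝓝 x, s z = t z) : T s x = T t x := by
  obtain ⟨χ, hχ, h2⟩ := exists_bump_vanishing (m := m) h
  have h3 : s - t = mulOp (χ ^ (k + 1)) (s - t) := by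
    ext z
    rcases h2 z with hz | hz <;> simp [hz]
  have h4 := apply_mulOp_eq_zero hT (Submodule.pow_mem_pow _ hχ (k + 1)) (s - t)
  rw [← h3, map_sub] at h4
  exact sub_eq_zero.1 h4

theorem exists_global_section {U : Set M} (hU : IsOpen U) {x : M} (hx : x ∈ U) {s : ∀ z, E z}
    (hs : ContMDiffOn (𝓡 m) ((𝓡 m).prod 𝓘(ℝ, Fin n → ℝ)) ∞
      (fun z => TotalSpace.mk' (Fin n → ℝ) z (s z)) U) :
    ∃ t : Cₛ^∞⟮𝓡 m; Fin n → ℝ, E⟯, ∀ᶠ z in 𝓝 x, t z = s z := by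
  obtain ⟨χ, h1, h2⟩ := exists_bump (m := m) (hU.mem_nhds hx)
  refine ⟨⟨fun z => χ z • s z,
    ContMDiffOn.smul_section_of_tsupport χ.contMDiff.contMDiffOn hU h1 hs⟩, ?_⟩
  filter_upwards [h2] with z hz
  change χ z • s z = s z
  rw [hz, one_smul]

end Operators

/-! ### Smooth functions in a chart -/

section Charts

variable {m : ℕ} {M : Type*} [TopologicalSpace M] [ChartedSpace (EuclideanSpace ℝ (Fin m)) M]
  {φ : OpenPartialHomeomorph M (EuclideanSpace ℝ (Fin m))}

theorem contDiffAt_comp_chart_symm {V : Type*} [NormedAddCommGroup V] [NormedSpace ℝ V]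
    (hφ : φ ∈ IsManifold.maximalAtlas (𝓡 m) ∞ M) {x : M} (hx : x ∈ φ.source) {g : M → V}
    (hg : ContMDiffAt (𝓡 m) 𝓘(ℝ, V) ∞ g x) : ContDiffAt ℝ ∞ (fun y => g (φ.symm y)) (φ x) := by
  rw [← contMDiffAt_iff_contDiffAt]
  have h1 : ContMDiffAt (𝓡 m) (𝓡 m) ∞ φ.symm (φ x) :=
    (contMDiffOn_symm_of_mem_maximalAtlas hφ).contMDiffAt
      (φ.open_target.mem_nhds (φ.map_source hx))
  refine ContMDiffAt.comp (φ x) ?_ h1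
  rwa [φ.left_inv hx]

theorem contMDiffOn_chart_comp (hφ : φ ∈ IsManifold.maximalAtlas (𝓡 m) ∞ M)
    {G : EuclideanSpace ℝ (Fin m) → ℝ} (hG : ContDiff ℝ ∞ G) :
    ContMDiffOn (𝓡 m) 𝓘(ℝ, ℝ) ∞ (fun z => G (φ z)) φ.source :=
  hG.contMDiff.comp_contMDiffOn (contMDiffOn_of_mem_maximalAtlas hφ)

/-- The value at `x` of the derivative `∂^α u` in the chart `φ`, as a functional of `u`. -/
def derivAt (hφ : φ ∈ IsManifold.maximalAtlas (𝓡 m) ∞ M) {x : M} (hx : x ∈ φ.source)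
    (α : Fin m → ℕ) : C^∞⟮𝓡 m, M; ℝ⟯ →ₗ[ℝ] ℝ where
  toFun u := multiDeriv α (fun y => u (φ.symm y)) (φ x)
  map_add' u v := multiDeriv_add α (contDiffAt_comp_chart_symm hφ hx u.contMDiff.contMDiffAt)
    (contDiffAt_comp_chart_symm hφ hx v.contMDiff.contMDiffAt)
  map_smul' c u := multiDeriv_clm_comp α (c • ContinuousLinearMap.id ℝ ℝ)
    (contDiffAt_comp_chart_symm hφ hx u.contMDiff.contMDiffAt)

theorem vanishesAt_of_mem_pow (hφ : φ ∈ IsManifold.maximalAtlas (𝓡 m) ∞ M) {x : M}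
    (hx : x ∈ φ.source) {r : ℕ} {h : C^∞⟮𝓡 m, M; ℝ⟯} (hh : h ∈ vanishingAt x ^ r) :
    VanishesAt (φ x) r fun y => h (φ.symm y) := by
  have hs (u : C^∞⟮𝓡 m, M; ℝ⟯) : ContDiffAt ℝ ∞ (fun y => u (φ.symm y)) (φ x) :=
    contDiffAt_comp_chart_symm hφ hx u.contMDiff.contMDiffAt
  induction r generalizing h with
  | zero => exact hs h
  | succ r ih =>
    rw [pow_succ] at hh
    induction hh using Submodule.mul_induction_on' with
    | mem_mul_mem a ha b hb =>
      exact (ih ha).smul (b := 1) (f := fun y => b (φ.symm y)) ⟨hs b, by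
        simpa [φ.left_inv hx] using mem_vanishingAt.1 hb, fun i => contDiffAt_partialDeriv i (hs b)⟩
    | add a _ b _ ha hb => exact ha.add hb

/-- The monomial `∏ᵢ (ξᵢ - ξᵢ(x))^βᵢ`. -/
def coordMonomial (x : M) (ξ : Fin m → C^∞⟮𝓡 m, M; ℝ⟯) (β : Fin m → ℕ) : C^∞⟮𝓡 m, M; ℝ⟯ :=
  ∏ i, centered x (ξ i) ^ β i

@[simp]
theorem coordMonomial_apply (x : M) (ξ : Fin m → C^∞⟮𝓡 m, M; ℝ⟯) (β : Fin m → ℕ) (z : M) :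
    coordMonomial x ξ β z = ∏ i, (ξ i z - ξ i x) ^ β i := by
  rw [coordMonomial, ← List.prod_ofFn, coe_list_prod, List.map_ofFn, List.prod_ofFn]
  simp

/-- The list in which each `ξᵢ` appears `βᵢ` times. -/
def multiList {R : Type*} (ξ : Fin m → R) (β : Fin m → ℕ) : List R :=
  ((List.finRange m).map fun i => List.replicate (β i) (ξ i)).flatten

theorem length_multiList {R : Type*} (ξ : Fin m → R) (β : Fin m → ℕ) :
    (multiList ξ β).length = ∑ i, β i := by
  rw [multiList, List.length_flatten, List.map_map, ← List.ofFn_eq_map, List.sum_ofFn]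
  simp

theorem prod_map_centered_multiList (x : M) (ξ : Fin m → C^∞⟮𝓡 m, M; ℝ⟯) (β : Fin m → ℕ) :
    ((multiList ξ β).map (centered x)).prod = coordMonomial x ξ β := by
  rw [multiList, List.map_flatten, List.prod_flatten, List.map_map, List.map_map,
    ← List.ofFn_eq_map, List.prod_ofFn, coordMonomial]
  simp

theorem derivAt_coordMonomial (hφ : φ ∈ IsManifold.maximalAtlas (𝓡 m) ∞ M) {x : M}
    (hx : x ∈ φ.source) {ξ : Fin m → C^∞⟮𝓡 m, M; ℝ⟯}
    (hξ : ∀ᶠ z in 𝓝 x, ∀ i, ξ i z = φ z i) (α γ : Fin m → ℕ) :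
    derivAt hφ hx α (coordMonomial x ξ γ) = if α = γ then ∏ i, ((α i).factorial : ℝ) else 0 := by
  have h : (fun y => coordMonomial x ξ γ (φ.symm y)) =ᶠ[𝓝 (φ x)] monomialAt (φ x) γ := by
    have h1 : Tendsto φ.symm (𝓝 (φ x)) (𝓝 x) := by
      simpa [ContinuousAt, φ.left_inv hx] using φ.continuousAt_symm (φ.map_source hx)
    filter_upwards [h1.eventually hξ, φ.open_target.mem_nhds (φ.map_source hx)] with y hy hy'
    simp [monomialAt, hy, hξ.self_of_nhds, φ.right_inv hy']
  have h2 : derivAt hφ hx α (coordMonomial x ξ γ) = multiDeriv α (monomialAt (φ x) γ) (φ x) :=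
    (eventuallyEq_multiDeriv α h).self_of_nhds
  rw [h2]
  split_ifs with hαγ
  · rw [← hαγ, multiDeriv_monomialAt_self]
  · exact multiDeriv_monomialAt_of_ne _ hαγ

theorem derivAt_eq_zero (hφ : φ ∈ IsManifold.maximalAtlas (𝓡 m) ∞ M) {x : M}
    (hx : x ∈ φ.source) {r : ℕ} {h : C^∞⟮𝓡 m, M; ℝ⟯} (hh : h ∈ vanishingAt x ^ r)
    {α : Fin m → ℕ} (hα : ∑ i, α i < r) : derivAt hφ hx α h = 0 :=
  (vanishesAt_of_mem_pow hφ hx hh).multiDeriv_eq_zero hα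

/-! ### Taylor expansion of smooth functions modulo a power of the ideal of a point -/

/-- Pure algebra: expand the power of `W + I²`; since `W ≤ I`, every term containing a factor from
`I²` falls into `I^(k+1)`. -/
theorem vanishingAt_pow_le {x : M} {W : Submodule ℝ C^∞⟮𝓡 m, M; ℝ⟯} (hW : W ≤ vanishingAt x)
    (h : vanishingAt x ≤ W ⊔ vanishingAt x ^ 2) (k : ℕ) :
    vanishingAt x ^ k ≤ W ^ k ⊔ vanishingAt x ^ (k + 1) := by
  induction k with
  | zero => simp
  | succ k ih =>
    calc vanishingAt x ^ (k + 1) = vanishingAt x ^ k * vanishingAt x := pow_succ _ _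
      _ ≤ (W ^ k ⊔ vanishingAt x ^ (k + 1)) * vanishingAt x := mul_le_mul_left ih _
      _ = W ^ k * vanishingAt x ⊔ vanishingAt x ^ (k + 1 + 1) := by
        rw [Submodule.sup_mul, ← pow_succ]
      _ ≤ W ^ k * (W ⊔ vanishingAt x ^ 2) ⊔ vanishingAt x ^ (k + 1 + 1) :=
        sup_le_sup_right (mul_le_mul_right h _) _
      _ = W ^ (k + 1) ⊔ W ^ k * vanishingAt x ^ 2 ⊔ vanishingAt x ^ (k + 1 + 1) := by
        rw [Submodule.mul_sup, ← pow_succ]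
      _ ≤ W ^ (k + 1) ⊔ vanishingAt x ^ (k + 1 + 1) := by
        refine sup_le (sup_le le_sup_left ?_) le_sup_right
        refine le_sup_of_le_right ((mul_le_mul_left (pow_le_pow_left' hW k) _).trans ?_)
        rw [← pow_add]

variable [T2Space M] [IsManifold (𝓡 m) ∞ M]

/-- By Hadamard, `u = ∑ (ξᵢ - ξᵢ(x)) gᵢ` near `x`. Freezing each `gᵢ` at `x` costs an element of
`I²`, and the remainder vanishing near `x` is in `I²` as well. -/
theorem vanishingAt_le_span_sup_sq (hφ : φ ∈ IsManifold.maximalAtlas (𝓡 m) ∞ M) {x : M}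
    (hx : x ∈ φ.source) {ξ : Fin m → C^∞⟮𝓡 m, M; ℝ⟯}
    (hξ : ∀ᶠ z in 𝓝 x, ∀ i, ξ i z = φ z i) :
    vanishingAt x ≤ Submodule.span ℝ (Set.range fun i => centered x (ξ i)) ⊔
      vanishingAt x ^ 2 := by
  intro u hu
  obtain ⟨F, hF⟩ := exists_global_function (m := m) φ.open_target (φ.map_source hx)
    (g := fun y => u (φ.symm y))
    (u.contMDiff.comp_contMDiffOn (contMDiffOn_symm_of_mem_maximalAtlas hφ))
  obtain ⟨G, hG, hFG⟩ := exists_hadamard_factors (contMDiff_iff_contDiff.1 F.contMDiff) (φ x)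
  choose g hg using fun i =>
    exists_global_function φ.open_source hx (contMDiffOn_chart_comp hφ (hG i))
  have hr : u - ∑ i, centered x (ξ i) * g i ∈ vanishingAt x ^ (1 + 1) := by
    refine mem_vanishingAt_pow_of_eventually_eq_zero ?_ 1
    have h1 : ∀ᶠ z in 𝓝 x, ∀ i, g i z = G i (φ z) := eventually_all.2 hg
    filter_upwards [hξ, h1, (φ.continuousAt hx).eventually hF, φ.open_source.mem_nhds hx]
      with z h2 h3 h4 h5
    have h6 : F (φ x) = 0 := by
      rw [hF.self_of_nhds, φ.left_inv hx]; exact hu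
    rw [φ.left_inv h5, hFG, h6] at h4
    have h7 : (∑ i, centered x (ξ i) * g i) z = ∑ i, (ξ i z - ξ i x) * g i z := by
      rw [← List.sum_ofFn, ← List.sum_ofFn]
      simp only [List.ofFn_eq_map]
      induction List.finRange m with
      | nil => rfl
      | cons a l ih =>
        simp only [List.map_cons, List.sum_cons, ← ih]
        rfl
    have h8 : (u - ∑ i, centered x (ξ i) * g i) z = u z - (∑ i, centered x (ξ i) * g i) z := rfl
    rw [h8, h7, ← h4, zero_add, sub_eq_zero]
    exact Finset.sum_congr rfl fun i _ => by rw [h2, h3, hξ.self_of_nhds]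
  rw [← sub_add_cancel u (∑ i, centered x (ξ i) * g i)]
  refine add_mem (Submodule.mem_sup_right hr) (sum_mem fun i _ => ?_)
  have h9 : centered x (ξ i) * g i =
      (g i x) • centered x (ξ i) + centered x (ξ i) * centered x (g i) := by
    ext z
    change (ξ i z - ξ i x) * g i z =
      g i x * (ξ i z - ξ i x) + (ξ i z - ξ i x) * (g i z - g i x)
    ring
  rw [h9]
  refine add_mem (Submodule.mem_sup_left
    (Submodule.smul_mem _ _ (Submodule.subset_span ⟨i, rfl⟩))) (Submodule.mem_sup_right ?_)
  rw [pow_two]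
  exact Submodule.mul_mem_mul (centered_mem _ _) (centered_mem _ _)

/-- Linear maps that agree on the monomials of degree at most `k` and on the products of `k + 1`
functions vanishing at `x` are equal. -/
theorem linearMap_ext_taylor {V : Type*} [AddCommGroup V] [Module ℝ V]
    (hφ : φ ∈ IsManifold.maximalAtlas (𝓡 m) ∞ M) {x : M}
    (hx : x ∈ φ.source) {ξ : Fin m → C^∞⟮𝓡 m, M; ℝ⟯}
    (hξ : ∀ᶠ z in 𝓝 x, ∀ i, ξ i z = φ z i) {k : ℕ} {f g : C^∞⟮𝓡 m, M; ℝ⟯ →ₗ[ℝ] V}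
    (hmon : ∀ β : Fin m → ℕ, ∑ i, β i ≤ k → f (coordMonomial x ξ β) = g (coordMonomial x ξ β))
    (hvan : ∀ h ∈ vanishingAt x ^ (k + 1), f h = g h) : f = g := by
  set D := LinearMap.eqLocus f g
  set W := Submodule.span ℝ (Set.range fun i => centered x (ξ i))
  have hW : W ≤ vanishingAt x := by
    refine Submodule.span_le.2 ?_
    rintro _ ⟨i, rfl⟩
    exact centered_mem _ _
  -- `W^j` is spanned by `j`-fold products of the `ξᵢ - ξᵢ(x)`; counting repetitions turns each
  -- product into a coordinate monomial of degree `j`.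
  have hWD (j : ℕ) (hj : j ≤ k) : W ^ j ≤ D := by
    rw [Submodule.span_pow, Submodule.span_le]
    intro a ha
    obtain ⟨w, rfl⟩ := Set.mem_pow.1 ha
    choose v hv using fun l => (w l).2
    have : (List.ofFn fun l => (w l : C^∞⟮𝓡 m, M; ℝ⟯)).prod =
        coordMonomial x ξ fun i => (Finset.univ.filter fun l => v l = i).card := by
      rw [List.prod_ofFn, coordMonomial]
      simp only [← hv]
      rw [← Finset.prod_fiberwise' Finset.univ v fun i => centered x (ξ i)]
      simp
    rw [SetLike.mem_coe, this]
    refine hmon _ ?_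
    rw [← Finset.card_eq_sum_card_fiberwise (fun _ _ => Finset.mem_coe.2 (Finset.mem_univ _))]
    simpa using hj
  -- Descending induction on the exponent, from `I^(k+1)` to `I`.
  have hD (j : ℕ) (hj : j ≤ k) : vanishingAt x ^ (k + 1 - j) ≤ D := by
    induction j with
    | zero => exact fun h hh => hvan h hh
    | succ j ih =>
      refine (vanishingAt_pow_le hW (vanishingAt_le_span_sup_sq hφ hx hξ) _).trans
        (sup_le (hWD _ (by omega)) ?_)
      rw [show k + 1 - (j + 1) + 1 = k + 1 - j by omega]
      exact ih (by omega)
  ext1 u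
  have h1 : centered x u ∈ D := hD k le_rfl (by simpa using centered_mem x u)
  have h2 : (1 : C^∞⟮𝓡 m, M; ℝ⟯) ∈ D := hWD 0 (Nat.zero_le _) (by simpa using ⟨1, map_one _⟩)
  have h3 : u = centered x u + u x • 1 := by
    ext z
    change u z = u z - u x + u x * 1
    ring
  change u ∈ D
  rw [h3]
  exact add_mem h1 (Submodule.smul_mem _ _ h2)

end Charts

/-! ### Sections in a trivialization -/

section Trivialization

variable {m n : ℕ}
  {M : Type*} [TopologicalSpace M] [ChartedSpace (EuclideanSpace ℝ (Fin m)) M]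
  {E : M → Type*} [∀ x, AddCommGroup (E x)] [∀ x, Module ℝ (E x)]
  [∀ x, TopologicalSpace (E x)] [TopologicalSpace (TotalSpace (Fin n → ℝ) E)]
  [FiberBundle (Fin n → ℝ) E] [VectorBundle ℝ (Fin n → ℝ) E]
  {e : Trivialization (Fin n → ℝ) (TotalSpace.proj : TotalSpace (Fin n → ℝ) E → M)}
  {φ : OpenPartialHomeomorph M (EuclideanSpace ℝ (Fin m))}

/-- The components at `x` of a section in the trivialization `e`. -/
def coordAt (he : IsSmoothTrivialization m e) {x : M} (hx : x ∈ e.baseSet) :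
    Cₛ^∞⟮𝓡 m; Fin n → ℝ, E⟯ →ₗ[ℝ] (Fin n → ℝ) where
  toFun s := (e ⟨x, s x⟩).2
  map_add' s t := (he.linear x hx).map_add (s x) (t x)
  map_smul' c s := (he.linear x hx).map_smul c (s x)

theorem coordAt_mulOp (he : IsSmoothTrivialization m e) {x : M} (hx : x ∈ e.baseSet)
    (u : C^∞⟮𝓡 m, M; ℝ⟯) (s : Cₛ^∞⟮𝓡 m; Fin n → ℝ, E⟯) :
    coordAt he hx (mulOp u s) = u x • coordAt he hx s :=
  (he.linear x hx).map_smul (u x) (s x)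

omit [VectorBundle ℝ (Fin n → ℝ) E] [∀ x, AddCommGroup (E x)] [∀ x, Module ℝ (E x)]
  [∀ x, TopologicalSpace (E x)] [FiberBundle (Fin n → ℝ) E] in
theorem trivialization_injective {x : M} (hx : x ∈ e.baseSet) {v w : E x}
    (h : (e ⟨x, v⟩).2 = (e ⟨x, w⟩).2) : v = w := by
  have h0 (v : E x) : (e ⟨x, v⟩).1 = x := e.coe_fst (e.mem_source.2 hx)
  have h1 : (⟨x, v⟩ : TotalSpace (Fin n → ℝ) E) = ⟨x, w⟩ :=
    e.injOn (e.mem_source.2 hx) (e.mem_source.2 hx) (Prod.ext ((h0 v).trans (h0 w).symm) h)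
  simpa using h1

omit [VectorBundle ℝ (Fin n → ℝ) E] in
theorem contMDiffOn_coord (he : IsSmoothTrivialization m e) (s : Cₛ^∞⟮𝓡 m; Fin n → ℝ, E⟯) :
    ContMDiffOn (𝓡 m) 𝓘(ℝ, Fin n → ℝ) ∞ (fun x => (e ⟨x, s x⟩).2) e.baseSet :=
  contMDiff_snd.comp_contMDiffOn (he.contMDiffOn.comp s.contMDiff.contMDiffOn
    fun _ hx => e.mem_source.2 hx)

omit [VectorBundle ℝ (Fin n → ℝ) E] in
theorem contDiffAt_localRep (he : IsSmoothTrivialization m e)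
    (hφ : φ ∈ IsManifold.maximalAtlas (𝓡 m) ∞ M) (hφe : φ.source ⊆ e.baseSet) {x : M}
    (hx : x ∈ φ.source) (s : Cₛ^∞⟮𝓡 m; Fin n → ℝ, E⟯) :
    ContDiffAt ℝ ∞ (localRep e φ s) (φ x) :=
  contDiffAt_comp_chart_symm hφ hx
    ((contMDiffOn_coord he s).contMDiffAt (e.open_baseSet.mem_nhds (hφe hx)))

/-- Near `x`, the functions `ξᵢ` are the coordinates of the chart `φ` and the sections `σⱼ` form
the standard frame of the trivialization `e`. -/
structure IsAdapted (e : Trivialization (Fin n → ℝ)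
      (TotalSpace.proj : TotalSpace (Fin n → ℝ) E → M))
    (φ : OpenPartialHomeomorph M (EuclideanSpace ℝ (Fin m))) (x : M)
    (ξ : Fin m → C^∞⟮𝓡 m, M; ℝ⟯) (σ : Fin n → Cₛ^∞⟮𝓡 m; Fin n → ℝ, E⟯) : Prop where
  coord : ∀ᶠ z in 𝓝 x, ∀ i, ξ i z = φ z i
  frame : ∀ᶠ z in 𝓝 x, ∀ j, (e ⟨z, σ j z⟩).2 = Pi.single j 1

variable [T2Space M] [IsManifold (𝓡 m) ∞ M]

theorem exists_frame (he : IsSmoothTrivialization m e) {x : M} (hx : x ∈ e.baseSet) :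
    ∃ σ : Fin n → Cₛ^∞⟮𝓡 m; Fin n → ℝ, E⟯,
      ∀ᶠ z in 𝓝 x, ∀ j, (e ⟨z, σ j z⟩).2 = Pi.single j 1 := by
  have h (j : Fin n) : ∃ t : Cₛ^∞⟮𝓡 m; Fin n → ℝ, E⟯,
      ∀ᶠ z in 𝓝 x, t z = e.symm z (Pi.single j 1) := by
    refine exists_global_section e.open_baseSet hx ?_
    have h1 : ContMDiffOn (𝓡 m) ((𝓡 m).prod 𝓘(ℝ, Fin n → ℝ)) ∞
        (fun z : M => (z, (Pi.single j 1 : Fin n → ℝ))) e.baseSet :=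
      (contMDiff_id.prodMk contMDiff_const).contMDiffOn
    refine (he.contMDiffOn_symm.comp h1 fun z hz => e.mem_target.2 hz).congr fun z hz => ?_
    exact e.mk_symm hz _
  choose σ hσ using h
  refine ⟨σ, ?_⟩
  filter_upwards [eventually_all.2 hσ, e.open_baseSet.mem_nhds hx] with z hz hz' j
  rw [hz j, e.apply_mk_symm hz']

theorem exists_isAdapted (he : IsSmoothTrivialization m e)
    (hφ : φ ∈ IsManifold.maximalAtlas (𝓡 m) ∞ M) (hφe : φ.source ⊆ e.baseSet) {x : M}
    (hx : x ∈ φ.source) : ∃ ξ σ, IsAdapted e φ x ξ σ := by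
  obtain ⟨σ, hσ⟩ := exists_frame he (hφe hx)
  choose ξ hξ using fun i : Fin m => exists_global_function φ.open_source hx
    (contMDiffOn_chart_comp hφ (EuclideanSpace.proj i :
      EuclideanSpace ℝ (Fin m) →L[ℝ] ℝ).contDiff)
  exact ⟨ξ, σ, eventually_all.2 hξ, hσ⟩

omit [T2Space M] [IsManifold (𝓡 m) ∞ M] in
theorem coordAt_sum_mulOp (he : IsSmoothTrivialization m e) {x : M} (hx : x ∈ e.baseSet)
    {σ : Fin n → Cₛ^∞⟮𝓡 m; Fin n → ℝ, E⟯} (hσ : ∀ j, (e ⟨x, σ j x⟩).2 = Pi.single j 1)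
    (h : Fin n → C^∞⟮𝓡 m, M; ℝ⟯) :
    coordAt he hx (∑ j, mulOp (h j) (σ j)) = fun j => h j x := by
  have hσ' (j : Fin n) : coordAt he hx (σ j) = Pi.single j 1 := hσ j
  ext i
  simp [map_sum, coordAt_mulOp, hσ', Pi.single_apply]

/-! ### The local form of an operator in the filtration -/

variable {k : ℕ} {T : Module.End ℝ Cₛ^∞⟮𝓡 m; Fin n → ℝ, E⟯}

/-- Both sides are linear in `h`, agree on monomials of degree at most `k`, and vanish on `I^(k+1)`.
-/
theorem coordAt_apply_mulOp (hT : T ∈ opFiltration m n M E k) (he : IsSmoothTrivialization m e)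
    (hφ : φ ∈ IsManifold.maximalAtlas (𝓡 m) ∞ M) (hφe : φ.source ⊆ e.baseSet) {x : M}
    (hx : x ∈ φ.source) {ξ : Fin m → C^∞⟮𝓡 m, M; ℝ⟯}
    (hξ : ∀ᶠ z in 𝓝 x, ∀ i, ξ i z = φ z i) (h : C^∞⟮𝓡 m, M; ℝ⟯)
    (t : Cₛ^∞⟮𝓡 m; Fin n → ℝ, E⟯) :
    coordAt he (hφe hx) (T (mulOp h t)) =
      ∑ r ∈ Finset.range (k + 1), ∑ α ∈ multiIndices m r, derivAt hφ hx α h •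
        (∏ i, ((α i).factorial : ℝ))⁻¹ •
          coordAt he (hφe hx) (T (mulOp (coordMonomial x ξ α) t)) := by
  let f : C^∞⟮𝓡 m, M; ℝ⟯ →ₗ[ℝ] (Fin n → ℝ) :=
    { toFun := fun h => coordAt he (hφe hx) (T (mulOp h t))
      map_add' := fun u v => by rw [mulOp_add, map_add, map_add]
      map_smul' := fun c v => by rw [mulOp_smul, map_smul, map_smul]; rfl }
  let g : C^∞⟮𝓡 m, M; ℝ⟯ →ₗ[ℝ] (Fin n → ℝ) :=
    ∑ r ∈ Finset.range (k + 1), ∑ α ∈ multiIndices m r, (derivAt hφ hx α).smulRight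
      ((∏ i, ((α i).factorial : ℝ))⁻¹ • coordAt he (hφe hx) (T (mulOp (coordMonomial x ξ α) t)))
  have hg (h : C^∞⟮𝓡 m, M; ℝ⟯) : g h = ∑ r ∈ Finset.range (k + 1), ∑ α ∈ multiIndices m r,
      derivAt hφ hx α h • (∏ i, ((α i).factorial : ℝ))⁻¹ •
          coordAt he (hφe hx) (T (mulOp (coordMonomial x ξ α) t)) := by
    simp [g, LinearMap.sum_apply]
  have hmem {α : Fin m → ℕ} {r : ℕ} : α ∈ multiIndices m r ↔ ∑ i, α i = r := by
    simp [multiIndices, Finset.mem_piAntidiag]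
  rw [← hg]
  refine LinearMap.congr_fun (f := f) (linearMap_ext_taylor (k := k) hφ hx hξ
    (fun β hβ => ?_) fun h hh => ?_) h
  · rw [hg, Finset.sum_eq_single (∑ i, β i), Finset.sum_eq_single β]
    · rw [derivAt_coordMonomial hφ hx hξ, if_pos rfl, smul_smul, mul_inv_cancel₀, one_smul]
      · rfl
      · exact Finset.prod_ne_zero_iff.2 fun i _ => Nat.cast_ne_zero.2 (Nat.factorial_ne_zero _)
    · intro α _ hα
      rw [derivAt_coordMonomial hφ hx hξ, if_neg hα, zero_smul]
    · exact fun h => (h (hmem.2 rfl)).elim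
    · intro r _ hr
      refine Finset.sum_eq_zero fun α hα => ?_
      rw [derivAt_coordMonomial hφ hx hξ, if_neg, zero_smul]
      rintro rfl
      exact hr (hmem.1 hα).symm
    · exact fun h => (h (Finset.mem_range.2 (by omega))).elim
  · rw [hg, Finset.sum_eq_zero]
    · change (e ⟨x, T (mulOp h t) x⟩).2 = 0
      rw [apply_mulOp_eq_zero hT hh]
      exact (he.linear x (hφe hx)).map_zero
    · intro r hr
      refine Finset.sum_eq_zero fun α hα => ?_
      rw [derivAt_eq_zero hφ hx hh, zero_smul]
      rw [hmem.1 hα]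
      exact Finset.mem_range.1 hr

/-- By locality `s` may be replaced by `∑ h_j σ_j`, with `h_j` its components near `x`; the scalar
expansion then applies to each `h_j`. -/
theorem coordAt_apply (hT : T ∈ opFiltration m n M E k) (he : IsSmoothTrivialization m e)
    (hφ : φ ∈ IsManifold.maximalAtlas (𝓡 m) ∞ M) (hφe : φ.source ⊆ e.baseSet) {x : M}
    (hx : x ∈ φ.source) {ξ : Fin m → C^∞⟮𝓡 m, M; ℝ⟯} {σ : Fin n → Cₛ^∞⟮𝓡 m; Fin n → ℝ, E⟯}
    (hA : IsAdapted e φ x ξ σ) (s : Cₛ^∞⟮𝓡 m; Fin n → ℝ, E⟯) :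
    coordAt he (hφe hx) (T s) =
      ∑ r ∈ Finset.range (k + 1), ∑ α ∈ multiIndices m r,
        ∑ j, multiDeriv α (localRep e φ s) (φ x) j • (∏ i, ((α i).factorial : ℝ))⁻¹ •
          coordAt he (hφe hx) (T (mulOp (coordMonomial x ξ α) (σ j))) := by
  choose h hh using fun j => exists_global_function e.open_baseSet (hφe hx)
    ((ContinuousLinearMap.proj (R := ℝ) (φ := fun _ : Fin n => ℝ) j).contMDiff.comp_contMDiffOn
      (contMDiffOn_coord he s))
  have hh' : ∀ᶠ z in 𝓝 x, ∀ j, h j z = (e ⟨z, s z⟩).2 j := eventually_all.2 hh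
  have hs : T s x = T (∑ j, mulOp (h j) (σ j)) x := by
    refine apply_congr_of_eventuallyEq hT ?_
    filter_upwards [hh', hA.frame, e.open_baseSet.mem_nhds (hφe hx)] with z h1 h2 h3
    refine trivialization_injective h3 ?_
    change _ = coordAt he h3 (∑ j, mulOp (h j) (σ j))
    rw [coordAt_sum_mulOp he h3 h2]
    exact (funext h1).symm
  have hd (α : Fin m → ℕ) (j : Fin n) :
      derivAt hφ hx α (h j) = multiDeriv α (localRep e φ s) (φ x) j := by
    have h1 : Tendsto φ.symm (𝓝 (φ x)) (𝓝 x) := by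
      simpa [ContinuousAt, φ.left_inv hx] using φ.continuousAt_symm (φ.map_source hx)
    have h2 : (fun y => h j (φ.symm y)) =ᶠ[𝓝 (φ x)] fun y =>
        ContinuousLinearMap.proj (R := ℝ) (φ := fun _ : Fin n => ℝ) j (localRep e φ s y) := by
      filter_upwards [h1.eventually hh'] with y hy
      exact hy j
    exact (eventuallyEq_multiDeriv α h2).self_of_nhds.trans
      (multiDeriv_clm_comp α _ (contDiffAt_localRep he hφ hφe hx s))
  have h1 : coordAt he (hφe hx) (T s) = coordAt he (hφe hx) (T (∑ j, mulOp (h j) (σ j))) := by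
    change (e ⟨x, T s x⟩).2 = _
    rw [hs]
    rfl
  rw [h1, map_sum, map_sum, Finset.sum_congr rfl fun j _ =>
    coordAt_apply_mulOp hT he hφ hφe hx hA.coord (h j) (σ j), Finset.sum_comm]
  refine Finset.sum_congr rfl fun r _ => ?_
  rw [Finset.sum_comm]
  simp only [hd]

omit [IsManifold (𝓡 m) ∞ M] [T2Space M] [VectorBundle ℝ (Fin n → ℝ) E]
  [∀ x, Module ℝ (E x)] [∀ x, AddCommGroup (E x)] in
theorem IsAdapted.eventually {x : M} {ξ : Fin m → C^∞⟮𝓡 m, M; ℝ⟯}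
    {σ : Fin n → Cₛ^∞⟮𝓡 m; Fin n → ℝ, E⟯} (hA : IsAdapted e φ x ξ σ) :
    ∀ᶠ z in 𝓝 x, IsAdapted e φ z ξ σ := by
  filter_upwards [hA.coord.eventually_nhds, hA.frame.eventually_nhds] with z h1 h2
  exact ⟨h1, h2⟩

/-- Coordinates and frame are chosen separately at each point; locality makes the coefficients
independent of that choice, so near `x₀` the data chosen at `x₀` may be used. -/
theorem apply_monomial_frame_unique (hT : T ∈ opFiltration m n M E k) {x : M} (hx : x ∈ e.baseSet)
    {ξ ξ' : Fin m → C^∞⟮𝓡 m, M; ℝ⟯} {σ σ' : Fin n → Cₛ^∞⟮𝓡 m; Fin n → ℝ, E⟯}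
    (hA : IsAdapted e φ x ξ σ) (hA' : IsAdapted e φ x ξ' σ') (α : Fin m → ℕ) (j : Fin n) :
    T (mulOp (coordMonomial x ξ α) (σ j)) x = T (mulOp (coordMonomial x ξ' α) (σ' j)) x := by
  refine apply_congr_of_eventuallyEq hT ?_
  filter_upwards [hA.coord, hA.frame, hA'.coord, hA'.frame, e.open_baseSet.mem_nhds hx]
    with z h1 h2 h3 h4 h5
  have h6 : σ j z = σ' j z := trivialization_injective h5 ((h2 j).trans (h4 j).symm)
  simp [h1, h3, h6, hA.coord.self_of_nhds, hA'.coord.self_of_nhds]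

theorem hasLocalForm_of_mem (hT : T ∈ opFiltration m n M E k) (he : IsSmoothTrivialization m e)
    (hφ : φ ∈ IsManifold.maximalAtlas (𝓡 m) ∞ M) (hφe : φ.source ⊆ e.baseSet) :
    HasLocalForm k e φ T := by
  choose! ξ σ hA using fun x (hx : x ∈ φ.source) => exists_isAdapted he hφ hφe hx
  let A : (Fin m → ℕ) → M → Matrix (Fin n) (Fin n) ℝ := fun α x => Matrix.of fun i j =>
    (∏ i, ((α i).factorial : ℝ))⁻¹ *
      (e ⟨x, T (mulOp (coordMonomial x (ξ x) α) (σ x j)) x⟩).2 i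
  have hsmooth (α : Fin m → ℕ) (i j : Fin n) :
      ContMDiffOn (𝓡 m) 𝓘(ℝ, ℝ) ∞ (fun x => A α x i j) φ.source := by
    intro x₀ hx₀
    refine ContMDiffAt.contMDiffWithinAt ?_
    -- With `ξ x₀` fixed, the coefficients near `x₀` are components of the single smooth section `S
    -- (σ x₀ j)`.
    set S := iterComm (multiList (ξ x₀) α) T
    have h1 : ContMDiffAt (𝓡 m) 𝓘(ℝ, ℝ) ∞ (fun x => (∏ i, ((α i).factorial : ℝ))⁻¹ *
        (e ⟨x, S (σ x₀ j) x⟩).2 i) x₀ :=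
      contMDiffAt_const.mul ((ContinuousLinearMap.proj (R := ℝ)
        (φ := fun _ : Fin n => ℝ) i).contMDiff.contMDiffAt.comp x₀
        ((contMDiffOn_coord he (S (σ x₀ j))).contMDiffAt (e.open_baseSet.mem_nhds (hφe hx₀))))
    refine h1.congr_of_eventuallyEq ?_
    filter_upwards [(hA x₀ hx₀).eventually, φ.open_source.mem_nhds hx₀] with x h2 hx
    simp only [A, Matrix.of_apply, S]
    rw [iterComm_apply, prod_map_centered_multiList,
      apply_monomial_frame_unique hT (hφe hx) (hA x hx) h2 α j]
  have hform (s : Cₛ^∞⟮𝓡 m; Fin n → ℝ, E⟯) (x : M) (hx : x ∈ φ.source) :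
      (e ⟨x, T s x⟩).2 = ∑ r ∈ Finset.range (k + 1), ∑ α ∈ multiIndices m r,
        (A α x).mulVec (multiDeriv α (localRep e φ s) (φ x)) := by
    refine (coordAt_apply hT he hφ hφe hx (hA x hx) s).trans ?_
    refine Finset.sum_congr rfl fun r _ => Finset.sum_congr rfl fun α _ => ?_
    ext i
    simp only [Finset.sum_apply, Pi.smul_apply, smul_eq_mul, Matrix.mulVec, dotProduct, A,
      Matrix.of_apply]
    refine Finset.sum_congr rfl fun j _ => ?_
    rw [mul_comm]
    rfl
  have htop (x : M) (hx : x ∈ φ.source) {β : Fin m → ℕ} (hβ : β ∈ multiIndices m k) :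
      ∃ c : ℝ, A β x = Matrix.of fun i j => if i = j then c else 0 := by
    obtain ⟨v, hv⟩ := mem_opFiltration_iff.1 hT (multiList (ξ x) β) (by
      rw [length_multiList]
      simpa [multiIndices, Finset.mem_piAntidiag] using hβ)
    refine ⟨(∏ i, ((β i).factorial : ℝ))⁻¹ * v x, ?_⟩
    ext i j
    simp only [A, Matrix.of_apply]
    rw [← prod_map_centered_multiList, ← iterComm_apply, ← hv]
    have h1 : (e ⟨x, mulOp v (σ x j) x⟩).2 = v x • (e ⟨x, σ x j x⟩).2 :=
      coordAt_mulOp he (hφe hx) v (σ x j)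
    rw [h1, (hA x hx).frame.self_of_nhds j]
    simp [Pi.single_apply]
  -- The scalar is read off the first diagonal entry; for `n = 0` there is none and any value will
  -- do.
  refine ⟨A, fun β x => if h : 0 < n then A β x ⟨0, h⟩ ⟨0, h⟩ else 0, hsmooth, fun β => ?_,
    fun s x hx => ?_⟩
  · by_cases h : 0 < n
    · simpa [h] using hsmooth β ⟨0, h⟩ ⟨0, h⟩
    · simpa [h] using contMDiffOn_const
  · rw [hform s x hx, Finset.sum_range_succ]
    congr 1
    refine Finset.sum_congr rfl fun β hβ => ?_
    obtain ⟨c, hc⟩ := htop x hx hβ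
    ext i
    have hn : 0 < n := i.pos
    simp [hc, hn, Matrix.mulVec, dotProduct]

/-! ### Operators with local forms belong to the filtration -/

omit [T2Space M] [IsManifold (𝓡 m) ∞ M] in
theorem isSmoothTrivialization_trivializationAt [ContMDiffVectorBundle ∞ (Fin n → ℝ) E (𝓡 m)]
    (x : M) : IsSmoothTrivialization m (trivializationAt (Fin n → ℝ) E x) where
  linear _ hb := (trivializationAt (Fin n → ℝ) E x).linear ℝ hb
  contMDiffOn := Trivialization.contMDiffOn _
  contMDiffOn_symm := Trivialization.contMDiffOn_symm _

variable [ContMDiffVectorBundle ∞ (Fin n → ℝ) E (𝓡 m)]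

theorem mem_range_mulOp (hn : 0 < n) {S : Module.End ℝ Cₛ^∞⟮𝓡 m; Fin n → ℝ, E⟯}
    (h : ∀ x, ∃ c : ℝ, ∀ s, S s x = c • s x) : S ∈ Set.range mulOp := by
  choose c hc using h
  refine ⟨⟨c, fun x => ?_⟩, ?_⟩
  · have he := isSmoothTrivialization_trivializationAt (m := m) (n := n) (E := E) x
    have hx := FiberBundle.mem_baseSet_trivializationAt (Fin n → ℝ) E x
    set e := trivializationAt (Fin n → ℝ) E x
    obtain ⟨σ, hσ⟩ := exists_frame he hx
    have h1 : ContMDiffAt (𝓡 m) 𝓘(ℝ, ℝ) ∞ (fun z => (e ⟨z, S (σ ⟨0, hn⟩) z⟩).2 ⟨0, hn⟩) x :=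
      (ContinuousLinearMap.proj (R := ℝ) (φ := fun _ : Fin n => ℝ) ⟨0, hn⟩).contMDiff.contMDiffAt.comp
        x ((contMDiffOn_coord he (S (σ ⟨0, hn⟩))).contMDiffAt (e.open_baseSet.mem_nhds hx))
    refine h1.congr_of_eventuallyEq ?_
    filter_upwards [hσ, e.open_baseSet.mem_nhds hx] with z hz hze
    rw [hc, (he.linear z hze).map_smul, hz]
    simp
  · ext s x
    exact (hc x s).symm

theorem mem_of_hasLocalForm
    (h : ∀ (e : Trivialization (Fin n → ℝ) (TotalSpace.proj : TotalSpace (Fin n → ℝ) E → M))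
        (φ : OpenPartialHomeomorph M (EuclideanSpace ℝ (Fin m))), IsSmoothTrivialization m e →
        φ ∈ IsManifold.maximalAtlas (𝓡 m) ∞ M → φ.source ⊆ e.baseSet → HasLocalForm k e φ T) :
    T ∈ opFiltration m n M E k := by
  rw [mem_opFiltration_iff]
  intro l hl
  -- For rank zero all fibres are trivial, so every operator is multiplication by 0; otherwise a
  -- frame section exists to detect the scalar.
  rcases Nat.eq_zero_or_pos n with hn | hn
  · refine ⟨0, ?_⟩
    ext s x
    subst hn
    exact trivialization_injective (FiberBundle.mem_baseSet_trivializationAt (Fin 0 → ℝ) E x)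
      (Subsingleton.elim _ _)
  refine mem_range_mulOp hn fun x => ?_
  have he := isSmoothTrivialization_trivializationAt (m := m) (n := n) (E := E) x
  set e := trivializationAt (Fin n → ℝ) E x
  have hxe : x ∈ e.baseSet := FiberBundle.mem_baseSet_trivializationAt (Fin n → ℝ) E x
  -- The chart is shrunk so that the trivialization is defined over its whole domain.
  set φ := (chartAt (EuclideanSpace ℝ (Fin m)) x).restr e.baseSet
  have hφ : φ ∈ IsManifold.maximalAtlas (𝓡 m) ∞ M :=
    restr_mem_maximalAtlas _ (IsManifold.chart_mem_maximalAtlas x) e.open_baseSet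
  have hφs : φ.source = (chartAt (EuclideanSpace ℝ (Fin m)) x).source ∩ e.baseSet :=
    OpenPartialHomeomorph.restr_source' _ _ e.open_baseSet
  have hφe : φ.source ⊆ e.baseSet := hφs ▸ Set.inter_subset_right
  have hx : x ∈ φ.source := hφs ▸ ⟨mem_chart_source _ x, hxe⟩
  obtain ⟨A, u, -, -, hT⟩ := h e φ he hφ hφe
  set p := (l.map (centered x)).prod
  have hp : p ∈ vanishingAt x ^ k := by
    rw [← hl]
    exact prod_map_centered_mem x l
  have hpv := vanishesAt_of_mem_pow hφ hx hp
  refine ⟨∑ β ∈ multiIndices m k, u β x * derivAt hφ hx β p, fun s => ?_⟩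
  rw [iterComm_apply]
  refine trivialization_injective hxe ?_
  rw [hT _ x hx, (he.linear x hxe).map_smul]
  have hmem {α : Fin m → ℕ} {r : ℕ} (hα : α ∈ multiIndices m r) : ∑ i, α i = r := by
    simpa [multiIndices, Finset.mem_piAntidiag] using hα
  have hloc : (fun y => p (φ.symm y) • localRep e φ s y) =ᶠ[𝓝 (φ x)]
      localRep e φ (mulOp p s) := by
    filter_upwards [φ.open_target.mem_nhds (φ.map_source hx)] with y hy
    exact (coordAt_mulOp he (hφe (φ.map_target hy)) p s).symm
  have hs := contDiffAt_localRep he hφ hφe hx s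
  -- The first sum vanishes because `p • s` vanishes to order `k` at `x`; at order `k` every
  -- derivative falls on `p`.
  rw [Finset.sum_eq_zero, zero_add, Finset.sum_smul]
  · refine Finset.sum_congr rfl fun β hβ => ?_
    rw [← (eventuallyEq_multiDeriv β hloc).self_of_nhds,
      multiDeriv_smul_of_vanishesAt (by rwa [hmem hβ]) hs, mul_smul]
    have hsx : localRep e φ s (φ x) = (e ⟨x, s x⟩).2 :=
      congrArg (fun z => (e ⟨z, s z⟩).2) (φ.left_inv hx)
    rw [hsx]
    rfl
  · intro r hr
    refine Finset.sum_eq_zero fun α hα => ?_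
    rw [← (eventuallyEq_multiDeriv α hloc).self_of_nhds,
      (hpv.smul (b := 0) hs).multiDeriv_eq_zero, Matrix.mulVec_zero]
    rw [hmem hα]
    simpa using hr

end Trivialization

end QuantumPoisson

end

theorem mainTheorem5 {m n : ℕ}
    {M : Type*} [TopologicalSpace M] [T2Space M]
    [ChartedSpace (EuclideanSpace ℝ (Fin m)) M] [IsManifold (𝓡 m) ∞ M]
    {E : M → Type*} [∀ x, AddCommGroup (E x)] [∀ x, Module ℝ (E x)]
    [∀ x, TopologicalSpace (E x)] [TopologicalSpace (TotalSpace (Fin n → ℝ) E)]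
    [FiberBundle (Fin n → ℝ) E] [VectorBundle ℝ (Fin n → ℝ) E]
    [ContMDiffVectorBundle ∞ (Fin n → ℝ) E (𝓡 m)]
    (k : ℕ) (hk : 1 ≤ k) (T : Module.End ℝ Cₛ^∞⟮𝓡 m; Fin n → ℝ, E⟯) :
    T ∈ QuantumPoisson.opFiltration m n M E k ↔
      ∀ (e : Trivialization (Fin n → ℝ) (TotalSpace.proj : TotalSpace (Fin n → ℝ) E → M))
        (φ : OpenPartialHomeomorph M (EuclideanSpace ℝ (Fin m))),
        QuantumPoisson.IsSmoothTrivialization m e →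
        φ ∈ IsManifold.maximalAtlas (𝓡 m) ∞ M →
        φ.source ⊆ e.baseSet →
        QuantumPoisson.HasLocalForm k e φ T := by
  exact ⟨fun hT _ _ he hφ hφe => QuantumPoisson.hasLocalForm_of_mem hT he hφ hφe,
    QuantumPoisson.mem_of_hasLocalForm⟩
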